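/- Let $G$ be a cotorsion group, i.e. an abelian group with $\operatorname{Ext}(\mathbb{Q},G)=0$, meaning that every short exact sequence of abelian groups $0\to G\to B\to\mathbb{Q}\to 0$ is equivalent to the split one. For an abelian group $A$ define the Ulm subgroups recursively by $A^0:=A$, $A^{\mu+1}:=\bigcap_{n\ge 1} nA^{\mu}$ for every ordinal $\mu$, and $A^{\delta}:=\bigcap_{\mu<\delta}A^{\mu}$ for every limit ordinal $\delta$; the Ulm length $u(A)$ is the smallest ordinal $\mu$ with $A^{\mu+1}=A^{\mu}$. For a prime $p$ define similarly $p^0A:=A$, $p^{\mu+1}A:=p(p^{\mu}A)$, and $p^{\delta}A:=\bigcap_{\mu<\delta}p^{\mu}A$ for every limit ordinal $\delta$; the $p$-length $l_p(A)$ is the smallest ordinal $\mu$ with $p^{\mu+1}A=p^{\mu}A$. Then, for every ordinal $\lambda$, $u(G)\le\lambda$ if and only if $l_p(G)\le\omega\lambda$ for every prime $p$. -/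

import Mathlib

universe u

/-- A short exact sequence `0 → A → B → C → 0` of abelian groups. The middle group may be taken in
the universe of `A`, since it is in bijection with `A × C`. -/
structure AbExtension (C : Type) (A : Type u) [AddCommGroup C] [AddCommGroup A] where
  /-- the middle group -/
  B : Type u
  [addCommGroup : AddCommGroup B]
  /-- the map `A → B` -/
  f : A →+ B
  /-- the map `B → C` -/
  g : B →+ C
  injective : Function.Injective f
  exact : Function.Exact f g
  surjective : Function.Surjective g

attribute [instance] AbExtension.addCommGroup

namespace AbExtension

variable {C : Type} {A : Type u} [AddCommGroup C] [AddCommGroup A]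

/-- Equivalence of extensions: an isomorphism of the middle groups that commutes with the maps
from `A` and the maps to `C`. -/
def Equivalent (E E' : AbExtension C A) : Prop :=
  ∃ e : E.B ≃+ E'.B, (∀ a, e (E.f a) = E'.f a) ∧ ∀ b, E'.g (e b) = E.g b

variable (C A) in
/-- The split extension `0 → A → A ⊕ C → C → 0`, the zero element of `Ext(C, A)`. -/
def split : AbExtension C A where
  B := A × C
  f := AddMonoidHom.inl A C
  g := AddMonoidHom.snd A C
  injective := fun a b h => congrArg Prod.fst h
  exact := by
    rintro ⟨a, c⟩
    constructor
    · intro h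
      exact ⟨a, Prod.ext rfl (Eq.symm h)⟩
    · rintro ⟨a', h⟩
      exact (congrArg Prod.snd h).symm
  surjective := fun c => ⟨(0, c), rfl⟩

end AbExtension

/-- `G` is cotorsion if `Ext(ℚ, G) = 0`: every extension of `ℚ` by `G` is equivalent to the split
extension. -/
def IsCotorsion (G : Type u) [AddCommGroup G] : Prop :=
  ∀ E : AbExtension ℚ G, E.Equivalent (AbExtension.split ℚ G)

section Filtrations

variable {A : Type u} [AddCommGroup A]

/-- The subgroup `n H = {n h | h ∈ H}`. -/
def mulSubgroup (n : ℕ) (H : AddSubgroup A) : AddSubgroup A :=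
  H.map (nsmulAddMonoidHom n)

theorem mem_mulSubgroup {n : ℕ} {H : AddSubgroup A} {x : A} :
    x ∈ mulSubgroup n H ↔ ∃ h ∈ H, n • h = x := Iff.rfl

theorem mulSubgroup_le (n : ℕ) (H : AddSubgroup A) : mulSubgroup n H ≤ H := by
  rintro _ ⟨h, hh, rfl⟩
  exact H.nsmul_mem hh n

/-- Transfinite iteration of an operation `F` on subgroups of `A`, starting at `A`, with
intersections at limit ordinals. -/
noncomputable def transIter (F : AddSubgroup A → AddSubgroup A) (o : Ordinal.{u}) :
    AddSubgroup A :=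
  Ordinal.limitRecOn o ⊤ (fun _ H => F H) (fun o _ ih => ⨅ (o' : Ordinal.{u}) (h : o' < o), ih o' h)

variable (F : AddSubgroup A → AddSubgroup A)

theorem transIter_zero : transIter F 0 = ⊤ := Ordinal.limitRecOn_zero ..

theorem transIter_add_one (o : Ordinal.{u}) : transIter F (o + 1) = F (transIter F o) :=
  Ordinal.limitRecOn_add_one ..

theorem transIter_limit {o : Ordinal.{u}} (ho : Order.IsSuccLimit o) :
    transIter F o = ⨅ (o' : Ordinal.{u}) (_ : o' < o), transIter F o' :=
  Ordinal.limitRecOn_limit (h := ho) ..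

variable {F} in
theorem transIter_antitone (hF : ∀ H, F H ≤ H) : Antitone (transIter F) := by
  intro a b
  induction b using Ordinal.limitRecOn with
  | zero =>
    intro h
    rw [nonpos_iff_eq_zero.mp h]
  | add_one b ih =>
    intro h
    rcases h.eq_or_lt with rfl | h
    · exact le_rfl
    · rw [transIter_add_one]
      exact (hF _).trans (ih (Order.lt_add_one_iff.mp h))
  | limit b hb ih =>
    intro h
    rcases h.eq_or_lt with rfl | h
    · exact le_rfl
    · rw [transIter_limit F hb]
      exact iInf₂_le a h

variable {F} in
theorem transIter_stabilizes (hF : ∀ H, F H ≤ H) :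
    {o : Ordinal.{u} | transIter F (o + 1) = transIter F o}.Nonempty := by
  have hni := not_injective_of_ordinal (transIter F)
  simp only [Function.Injective, not_forall] at hni
  obtain ⟨a, b, hab, hne⟩ := hni
  have key : ∀ a b : Ordinal.{u}, a < b → transIter F a = transIter F b →
      transIter F (a + 1) = transIter F a := fun a b hlt h =>
    le_antisymm (transIter_antitone hF (Order.le_succ a))
      (h.le.trans (transIter_antitone hF (Order.add_one_le_of_lt hlt)))
  rcases lt_or_gt_of_ne hne with hlt | hlt
  · exact ⟨a, key a b hlt hab⟩
  · exact ⟨b, key b a hlt hab.symm⟩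

end Filtrations

section Lengths

variable (A : Type u) [AddCommGroup A]

/-- The Ulm subgroups: `A^0 = A`, `A^(o+1) = ⋂_{n ≥ 1} n A^o`, intersections at limits. -/
noncomputable def ulmSubgroup (o : Ordinal.{u}) : AddSubgroup A :=
  transIter (fun H => ⨅ (n : ℕ) (_ : 1 ≤ n), mulSubgroup n H) o

/-- The subgroups `p^o A`: `p^0 A = A`, `p^(o+1) A = p (p^o A)`, intersections at limits. -/
noncomputable def pPowSubgroup (p : ℕ) (o : Ordinal.{u}) : AddSubgroup A :=
  transIter (mulSubgroup p) o

theorem ulmSubgroup_stabilizes :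
    {o : Ordinal.{u} | ulmSubgroup A (o + 1) = ulmSubgroup A o}.Nonempty :=
  transIter_stabilizes fun H => (iInf₂_le 1 le_rfl).trans (mulSubgroup_le 1 H)

theorem pPowSubgroup_stabilizes (p : ℕ) :
    {o : Ordinal.{u} | pPowSubgroup A p (o + 1) = pPowSubgroup A p o}.Nonempty :=
  transIter_stabilizes (mulSubgroup_le p)

/-- The Ulm length `u(A)`: the smallest ordinal `o` with `A^(o+1) = A^o`
(there is one by `ulmSubgroup_stabilizes`). -/
noncomputable def ulmLength : Ordinal.{u} :=
  sInf {o : Ordinal.{u} | ulmSubgroup A (o + 1) = ulmSubgroup A o}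

/-- The `p`-length `l_p(A)`: the smallest ordinal `o` with `p^(o+1) A = p^o A`
(there is one by `pPowSubgroup_stabilizes`). -/
noncomputable def pLength (p : ℕ) : Ordinal.{u} :=
  sInf {o : Ordinal.{u} | pPowSubgroup A p (o + 1) = pPowSubgroup A p o}

end Lengths

/-! In any abelian group `A^λ` is the intersection over all primes `p` of `p^(ωλ) A`
(`mem_ulmSubgroup_iff`), so stability of every `p^(ωλ) A` forces stability of `A^λ`. The converse
needs cotorsion. Since `ℤ[1/p] ∩ ℤ_(p) = ℤ` and `ℤ[1/p] + ℤ_(p) = ℚ`, each `x` in `G` splits as `b +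
a`, with `b` in a `p`-divisible subgroup and `a` in one divisible by all other primes
(`IsCotorsion.exists_add_eq`). If `x ∈ p^(ωλ) G`, then `b`, hence `a`, lies there too; `a` lies in
every other `q^(ωλ) G`, so `a ∈ G^λ = G^(λ+1) ⊆ p G^λ`. Both summands are therefore in `p (p^(ωλ)
G)`. -/

section Iteration

variable {A : Type u} [AddCommGroup A] {F : AddSubgroup A → AddSubgroup A}

theorem transIter_eq_of_stable (hF : ∀ H, F H ≤ H) {m : Ordinal.{u}}
    (hm : transIter F (m + 1) = transIter F m) {o : Ordinal.{u}} (ho : m ≤ o) :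
    transIter F o = transIter F m := by
  induction o using Ordinal.limitRecOn with
  | zero => rw [nonpos_iff_eq_zero.mp ho]
  | add_one b ih =>
    rcases ho.eq_or_lt with rfl | h
    · rfl
    · rw [transIter_add_one, ih (Order.lt_add_one_iff.mp h), ← transIter_add_one F, hm]
  | limit b hb ih =>
    refine le_antisymm (transIter_antitone hF ho) ?_
    rw [transIter_limit F hb]
    refine le_iInf₂ fun c hc => ?_
    rcases le_total m c with h | h
    · exact (ih c hc h).ge
    · exact transIter_antitone hF h

theorem sInf_stable_le_iff (hF : ∀ H, F H ≤ H) {o : Ordinal.{u}} :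
    sInf {a : Ordinal.{u} | transIter F (a + 1) = transIter F a} ≤ o ↔
      transIter F (o + 1) = transIter F o := by
  refine ⟨fun h => ?_, fun h => csInf_le' h⟩
  have hm := csInf_mem (transIter_stabilizes hF)
  rw [transIter_eq_of_stable hF hm h,
    transIter_eq_of_stable (o := o + 1) hF hm (h.trans (Order.le_succ o))]

end Iteration

/-! ### Ulm subgroups in terms of `p`-heights -/

section Heights

variable {A : Type u} [AddCommGroup A]

theorem ulmLength_le_iff {o : Ordinal.{u}} :
    ulmLength A ≤ o ↔ ulmSubgroup A (o + 1) = ulmSubgroup A o :=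
  sInf_stable_le_iff fun H => (iInf₂_le 1 le_rfl).trans (mulSubgroup_le 1 H)

theorem pLength_le_iff {p : ℕ} {o : Ordinal.{u}} :
    pLength A p ≤ o ↔ pPowSubgroup A p (o + 1) = pPowSubgroup A p o :=
  sInf_stable_le_iff (mulSubgroup_le p)

theorem pPowSubgroup_antitone (p : ℕ) : Antitone (pPowSubgroup A p) :=
  transIter_antitone (mulSubgroup_le p)

theorem mulSubgroup_mono (n : ℕ) {H K : AddSubgroup A} (h : H ≤ K) :
    mulSubgroup n H ≤ mulSubgroup n K :=
  AddSubgroup.map_mono h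

/-- A `p`-divisible subgroup lies in every `p^o A`. -/
theorem le_pPowSubgroup_of_le_mulSubgroup {p : ℕ} {D : AddSubgroup A} (hD : D ≤ mulSubgroup p D)
    (o : Ordinal.{u}) : D ≤ pPowSubgroup A p o := by
  induction o using Ordinal.limitRecOn with
  | zero => rw [pPowSubgroup, transIter_zero]; exact le_top
  | add_one b ih =>
    rw [pPowSubgroup, transIter_add_one]
    exact hD.trans (mulSubgroup_mono p ih)
  | limit b hb ih =>
    rw [pPowSubgroup, transIter_limit _ hb]
    exact le_iInf₂ ih

/-- By Bézout, `y` is an integer combination of `m • y` and `n • y`. -/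
theorem mem_mulSubgroup_of_coprime {m n : ℕ} (h : m.Coprime n) {H : AddSubgroup A} {y : A}
    (hy : y ∈ H) (hny : n • y ∈ mulSubgroup m H) : y ∈ mulSubgroup m H := by
  have hmy : m • y ∈ mulSubgroup m H := ⟨y, hy, rfl⟩
  have hb : ((m : ℤ) * m.gcdA n + n * m.gcdB n) • y = y := by
    rw [← Nat.gcd_eq_gcd_ab, h.gcd_eq_one, Nat.cast_one, one_zsmul]
  rw [← hb, add_zsmul, mul_comm, mul_zsmul, mul_comm (n : ℤ), mul_zsmul, natCast_zsmul,
    natCast_zsmul]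
  exact add_mem (zsmul_mem hmy _) (zsmul_mem hny _)

theorem mem_pPowSubgroup_of_coprime {p n : ℕ} (h : p.Coprime n) {y : A} (o : Ordinal.{u})
    (hny : n • y ∈ pPowSubgroup A p o) : y ∈ pPowSubgroup A p o := by
  induction o using Ordinal.limitRecOn with
  | zero => rw [pPowSubgroup, transIter_zero]; exact AddSubgroup.mem_top y
  | add_one b ih =>
    have hb : n • y ∈ pPowSubgroup A p b := pPowSubgroup_antitone p (Order.le_succ b) hny
    rw [pPowSubgroup, transIter_add_one] at hny ⊢
    exact mem_mulSubgroup_of_coprime h (ih hb) hny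
  | limit b hb ih =>
    rw [pPowSubgroup, transIter_limit _ hb] at hny ⊢
    simp only [AddSubgroup.mem_iInf] at hny ⊢
    exact fun c hc => ih c hc (hny c hc)

theorem mem_mulSubgroup_mul_of_coprime {m n : ℕ} (h : m.Coprime n) {H : AddSubgroup A} {x : A}
    (hm : x ∈ mulSubgroup m H) (hn : x ∈ mulSubgroup n H) : x ∈ mulSubgroup (m * n) H := by
  obtain ⟨y, hy, rfl⟩ := hm
  obtain ⟨z, hz, hyz⟩ := mem_mulSubgroup_of_coprime h.symm hy hn
  exact ⟨z, hz, by rw [← hyz]; exact mul_nsmul' z m n⟩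

theorem mem_mulSubgroup_of_forall_prime_pow {H : AddSubgroup A} {x : A} (hx : x ∈ H)
    (h : ∀ p k : ℕ, p.Prime → x ∈ mulSubgroup (p ^ k) H) (n : ℕ) :
    1 ≤ n → x ∈ mulSubgroup n H := by
  induction n using Nat.recOnPosPrimePosCoprime with
  | prime_pow p k hp _ => exact fun _ => h p k hp
  | zero => omega
  | one => exact fun _ => ⟨x, hx, one_nsmul x⟩
  | coprime a b ha hb hab iha ihb =>
    exact fun _ => mem_mulSubgroup_mul_of_coprime hab (iha ha.le) (ihb hb.le)

theorem pPowSubgroup_add_natCast (p : ℕ) (o : Ordinal.{u}) (k : ℕ) :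
    pPowSubgroup A p (o + k) = mulSubgroup (p ^ k) (pPowSubgroup A p o) := by
  induction k with
  | zero =>
    ext x
    simp [mem_mulSubgroup]
  | succ k ih =>
    rw [Nat.cast_succ, ← add_assoc, pPowSubgroup, transIter_add_one, ← pPowSubgroup, ih]
    ext x
    simp [mem_mulSubgroup, pow_succ, mul_nsmul]

theorem mem_pPowSubgroup_add_omega0 {p : ℕ} {o : Ordinal.{u}} {x : A} :
    x ∈ pPowSubgroup A p (o + Ordinal.omega0) ↔
      ∀ k : ℕ, x ∈ mulSubgroup (p ^ k) (pPowSubgroup A p o) := by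
  constructor
  · intro h k
    rw [← pPowSubgroup_add_natCast]
    exact pPowSubgroup_antitone p (by gcongr; exact (Ordinal.natCast_lt_omega0 k).le) h
  · intro h
    rw [pPowSubgroup, transIter_limit _ (Ordinal.isSuccLimit_add o Ordinal.isSuccLimit_omega0)]
    simp only [AddSubgroup.mem_iInf]
    intro c hc
    obtain ⟨d, hd, hcd⟩ := (Ordinal.lt_add_iff Ordinal.omega0_ne_zero).mp hc
    obtain ⟨k, rfl⟩ := Ordinal.lt_omega0.mp hd
    have := h k
    rw [← pPowSubgroup_add_natCast] at this
    exact pPowSubgroup_antitone p hcd this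

/-- The Ulm subgroup `A^o` is the intersection of the subgroups `p^(ω o) A`. -/
theorem mem_ulmSubgroup_iff {o : Ordinal.{u}} {x : A} :
    x ∈ ulmSubgroup A o ↔ ∀ p : ℕ, p.Prime → x ∈ pPowSubgroup A p (Ordinal.omega0 * o) := by
  induction o using Ordinal.limitRecOn generalizing x with
  | zero => simp [ulmSubgroup, pPowSubgroup, transIter_zero]
  | add_one o ih =>
    rw [ulmSubgroup, transIter_add_one, ← ulmSubgroup, mul_add, mul_one]
    simp only [AddSubgroup.mem_iInf, mem_pPowSubgroup_add_omega0]
    constructor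
    · intro h p hp k
      exact mulSubgroup_mono _ (fun y hy => ih.mp hy p hp) (h (p ^ k) (Nat.pow_pos hp.pos))
    · intro h n
      have hx : ∀ q : ℕ, q.Prime → x ∈ pPowSubgroup A q (Ordinal.omega0 * o) := fun q hq =>
        mulSubgroup_le _ _ (h q hq 0)
      refine mem_mulSubgroup_of_forall_prime_pow (ih.mpr hx) (fun p k hp => ?_) n
      obtain ⟨y, hy, hyx⟩ := h p hp k
      -- The `p^k`-th root `y` is chosen only for its `p`-height; for `q ≠ p`, multiplication by
      -- `p^k` does not change `q`-heights, so `y` inherits that of `x`.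
      refine ⟨y, ih.mpr fun q hq => ?_, hyx⟩
      by_cases hqp : q = p
      · exact hqp ▸ hy
      · refine mem_pPowSubgroup_of_coprime (n := p ^ k)
          (Nat.Coprime.pow_right k ((Nat.coprime_primes hq hp).mpr hqp)) _ ?_
        have := hx q hq
        rwa [← hyx] at this
  | limit o ho ih =>
    rw [ulmSubgroup, transIter_limit _ ho]
    simp only [AddSubgroup.mem_iInf]
    constructor
    · intro h p hp
      rw [pPowSubgroup, transIter_limit _
        (Ordinal.isSuccLimit_mul_right Ordinal.omega0_pos ho)]
      simp only [AddSubgroup.mem_iInf]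
      intro c hc
      obtain ⟨d, hd, hcd⟩ := (Ordinal.lt_mul_iff_of_isSuccLimit ho).mp hc
      exact pPowSubgroup_antitone p hcd.le ((ih d hd).mp (h d hd) p hp)
    · intro h c hc
      exact (ih c hc).mpr fun p hp => pPowSubgroup_antitone p (by gcongr) (h p hp)

end Heights

/-! ### Localizations of `ℤ` inside `ℚ` -/

section Localizations

/-- The subgroup of rationals whose denominator lies in the submonoid `S` of `ℕ`. -/
def ratLocalization (S : Submonoid ℕ) : AddSubgroup ℚ where
  carrier := {r | ∃ m ∈ S, ∃ n : ℤ, (m : ℚ) * r = n}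
  zero_mem' := ⟨1, S.one_mem, 0, by simp⟩
  add_mem' := by
    rintro a b ⟨m, hm, n, h⟩ ⟨m', hm', n', h'⟩
    refine ⟨m * m', S.mul_mem hm hm', m' * n + m * n', ?_⟩
    push_cast
    linear_combination (m' : ℚ) * h + (m : ℚ) * h'
  neg_mem' := by
    rintro a ⟨m, hm, n, h⟩
    exact ⟨m, hm, -n, by push_cast; linear_combination -h⟩

theorem one_mem_ratLocalization (S : Submonoid ℕ) : (1 : ℚ) ∈ ratLocalization S :=
  ⟨1, S.one_mem, 1, by simp⟩

theorem exists_nsmul_eq_ratLocalization {S : Submonoid ℕ} {n : ℕ} (hn : n ∈ S) (h0 : n ≠ 0)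
    (r : ratLocalization S) : ∃ s : ratLocalization S, n • s = r := by
  have hn0 : (n : ℚ) ≠ 0 := Nat.cast_ne_zero.mpr h0
  obtain ⟨r, m, hm, k, h⟩ := r
  refine ⟨⟨r / n, m * n, S.mul_mem hm hn, k, ?_⟩, Subtype.ext ?_⟩
  · rw [← h]; push_cast; field_simp
  · simp only [AddSubgroup.coe_nsmul, nsmul_eq_mul]
    field_simp

variable {S T : Submonoid ℕ}

theorem exists_int_of_mem_ratLocalization (h : ∀ m ∈ S, ∀ n ∈ T, m.Coprime n) {r : ℚ}
    (hS : r ∈ ratLocalization S) (hT : r ∈ ratLocalization T) : ∃ n : ℤ, r = n := by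
  obtain ⟨m, hm, a, ha⟩ := hS
  obtain ⟨n, hn, b, hb⟩ := hT
  have key : ((m : ℤ) * m.gcdA n + n * m.gcdB n) = 1 := by
    rw [← Nat.gcd_eq_gcd_ab, (h m hm n hn).gcd_eq_one, Nat.cast_one]
  have key' : ((m : ℚ) * (m.gcdA n : ℤ) + n * (m.gcdB n : ℤ)) = 1 := by exact_mod_cast key
  refine ⟨a * m.gcdA n + b * m.gcdB n, ?_⟩
  push_cast
  linear_combination (m.gcdA n : ℚ) * ha + (m.gcdB n : ℚ) * hb - r * key'

theorem exists_add_eq_of_coprime {m n : ℕ} (hm : m ∈ S) (hn : n ∈ T)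
    (h : m.Coprime n) {r : ℚ} {k : ℤ} (hr : ((m * n : ℕ) : ℚ) * r = k) :
    ∃ a ∈ ratLocalization S, ∃ b ∈ ratLocalization T, a + b = r := by
  have key : ((m : ℤ) * m.gcdA n + n * m.gcdB n) = 1 := by
    rw [← Nat.gcd_eq_gcd_ab, h.gcd_eq_one, Nat.cast_one]
  have key' : ((m : ℚ) * (m.gcdA n : ℤ) + n * (m.gcdB n : ℤ)) = 1 := by exact_mod_cast key
  push_cast at hr
  refine ⟨n * m.gcdB n * r, ⟨m, hm, k * m.gcdB n, ?_⟩, m * m.gcdA n * r,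
    ⟨n, hn, k * m.gcdA n, ?_⟩, ?_⟩
  · push_cast; linear_combination (m.gcdB n : ℚ) * hr
  · push_cast; linear_combination (m.gcdA n : ℚ) * hr
  · linear_combination r * key'

end Localizations

/-! ### Splitting elements of a cotorsion group -/

section Cotorsion

variable {G : Type u} [AddCommGroup G]

/-- If subgroups `P`, `L` of `ℚ` satisfy `P ∩ L = ℤ` and `P + L = ℚ`, then every element of a
cotorsion group is the sum of the images of `1` under homomorphisms from `P` and from `L`:
push out `0 → ℤ → P ⊕ L → ℚ → 0` along `1 ↦ x` and split the result. -/
theorem IsCotorsion.exists_hom_add_eq (hG : IsCotorsion G) {P L : AddSubgroup ℚ}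
    (hP : (1 : ℚ) ∈ P) (hL : (1 : ℚ) ∈ L) (hint : ∀ r ∈ P, r ∈ L → ∃ n : ℤ, r = n)
    (hsum : ∀ r : ℚ, ∃ a ∈ P, ∃ b ∈ L, a + b = r) (x : G) :
    ∃ (φ : P →+ G) (ψ : L →+ G), φ ⟨1, hP⟩ + ψ ⟨1, hL⟩ = x := by
  -- Killing `v` glues `x` to `(1, -1)`, the image of `1` under `ℤ → P ⊕ L`, whose cokernel map to
  -- `ℚ` is addition.
  let v : G × P × L := (x, -⟨1, hP⟩, ⟨1, hL⟩)
  let N : AddSubgroup (G × P × L) := AddSubgroup.zmultiples v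
  let s : G × P × L →+ ℚ :=
    (P.subtype.coprod L.subtype).comp (AddMonoidHom.snd G (P × L))
  have hs : ∀ t, s t = (t.2.1 : ℚ) + (t.2.2 : ℚ) := fun t => rfl
  have hN : N ≤ s.ker := by
    rw [AddSubgroup.zmultiples_le, AddMonoidHom.mem_ker, hs]
    simp [v]
  let E : AbExtension ℚ G :=
    { B := (G × P × L) ⧸ N
      f := (QuotientAddGroup.mk' N).comp (AddMonoidHom.inl G (P × L))
      g := QuotientAddGroup.lift N s hN
      injective := by
        rw [injective_iff_map_eq_zero]
        intro a ha
        obtain ⟨n, hn⟩ := AddSubgroup.mem_zmultiples_iff.mp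
          ((QuotientAddGroup.eq_zero_iff (N := N) _).mp ha)
        have h2 : n = 0 := by
          have := congrArg (fun t : G × P × L => (t.2.2 : ℚ)) hn
          simpa [v] using this
        have h1 := congrArg Prod.fst hn
        rw [h2] at h1
        simpa using h1.symm
      exact := by
        intro b
        constructor
        · induction b using QuotientAddGroup.induction_on with
          | H t =>
            intro ht
            obtain ⟨a, ⟨r, hr⟩, ⟨q, hq⟩⟩ := t
            have hrq : r + q = 0 := ht
            obtain ⟨n, hn⟩ := hint q (by rw [← neg_eq_of_add_eq_zero_right hrq]; exact neg_mem hr) hq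
            -- Here `(a, r, q) = (a, -n, n) = (a - n • x, 0, 0) + n • v`.
            refine ⟨a - n • x, ?_⟩
            refine (QuotientAddGroup.eq (s := N)).mpr (AddSubgroup.mem_zmultiples_iff.mpr ⟨n, ?_⟩)
            have hr' : r = -n := by rw [← hn]; exact eq_neg_of_add_eq_zero_left hrq
            refine Prod.ext ?_ (Prod.ext (Subtype.ext ?_) (Subtype.ext ?_))
            · simp [v]
            · simp [v, hr']
            · simp [v, hn]
        · rintro ⟨a, rfl⟩
          change s (a, 0, 0) = 0
          simp [hs]
      surjective := by
        intro r
        obtain ⟨a, ha, b, hb, hab⟩ := hsum r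
        exact ⟨QuotientAddGroup.mk' N (0, ⟨a, ha⟩, ⟨b, hb⟩), hab⟩ }
  obtain ⟨e, he, -⟩ := hG E
  -- The splitting gives a retraction onto `G` that kills `v`; its restrictions to `P` and `L`, the
  -- latter negated, are the required maps.
  let ρ : G × P × L →+ G :=
    ((AddMonoidHom.fst G ℚ).comp e.toAddMonoidHom).comp (QuotientAddGroup.mk' N)
  have hρ : ∀ a, ρ (a, 0, 0) = a := fun a => congrArg Prod.fst (he a)
  have hv : ρ v = 0 := by
    have : (QuotientAddGroup.mk' N) v = 0 :=
      (QuotientAddGroup.eq_zero_iff (N := N) v).mpr (AddSubgroup.mem_zmultiples v)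
    simp only [ρ, AddMonoidHom.comp_apply, this, map_zero]
  let ι : P →+ G × P × L := (AddMonoidHom.inr G (P × L)).comp (AddMonoidHom.inl P L)
  let κ : L →+ G × P × L := (AddMonoidHom.inr G (P × L)).comp (AddMonoidHom.inr P L)
  refine ⟨ρ.comp ι, -(ρ.comp κ), ?_⟩
  have hdecomp : v = (x, 0, 0) - ι ⟨1, hP⟩ + κ ⟨1, hL⟩ := by
    simp [v, ι, κ]
  rw [hdecomp, map_add, map_sub, hρ] at hv
  change ρ (ι ⟨1, hP⟩) + -ρ (κ ⟨1, hL⟩) = x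
  rw [← sub_eq_zero, ← neg_eq_zero, ← hv]
  abel

/-- In a cotorsion group, every element is the sum of an element of a `p`-divisible subgroup and an
element of a subgroup that is divisible by all primes other than `p`. -/
theorem IsCotorsion.exists_add_eq (hG : IsCotorsion G) {p : ℕ} (hp : p.Prime) (x : G) :
    ∃ D K : AddSubgroup G, D ≤ mulSubgroup p D ∧
      (∀ q : ℕ, q.Prime → q ≠ p → K ≤ mulSubgroup q K) ∧ ∃ b ∈ D, ∃ a ∈ K, b + a = x := by
  -- `S` yields `ℤ[1/p]` and `T` yields `ℤ_(p)`.
  let S : Submonoid ℕ := Submonoid.powers p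
  let T : Submonoid ℕ :=
    { carrier := {m | p.Coprime m}
      one_mem' := Nat.coprime_one_right p
      mul_mem' := fun ha hb => Nat.Coprime.mul_right ha hb }
  have hST : ∀ m ∈ S, ∀ n ∈ T, m.Coprime n := by
    rintro _ ⟨k, rfl⟩ n hn
    exact Nat.Coprime.pow_left k hn
  have hdiv : ∀ {U : Submonoid ℕ} {n : ℕ} (φ : ratLocalization U →+ G), n ∈ U → n ≠ 0 →
      φ.range ≤ mulSubgroup n φ.range := by
    rintro U n φ hn h0 _ ⟨r, rfl⟩
    obtain ⟨s, rfl⟩ := exists_nsmul_eq_ratLocalization hn h0 r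
    exact ⟨φ s, ⟨s, rfl⟩, (map_nsmul φ n s).symm⟩
  have hsum : ∀ r : ℚ, ∃ a ∈ ratLocalization S, ∃ b ∈ ratLocalization T, a + b = r := by
    intro r
    obtain ⟨k, m, hm, hk⟩ := Nat.exists_eq_pow_mul_and_not_dvd r.den_nz p hp.ne_one
    have hpm : p.Coprime m := (Nat.Prime.coprime_iff_not_dvd hp).mpr hm
    refine exists_add_eq_of_coprime (S := S) (T := T) (k := r.num) ⟨k, rfl⟩ hpm
      (Nat.Coprime.pow_left k hpm) ?_
    rw [← hk, mul_comm, Rat.mul_den_eq_num]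
  obtain ⟨φ, ψ, h⟩ := hG.exists_hom_add_eq (one_mem_ratLocalization S) (one_mem_ratLocalization T)
    (fun r hS hT => exists_int_of_mem_ratLocalization hST hS hT) hsum x
  refine ⟨φ.range, ψ.range, hdiv φ ⟨1, pow_one p⟩ hp.ne_zero, fun q hq hqp =>
    hdiv ψ ((Nat.coprime_primes hp hq).mpr (Ne.symm hqp)) hq.ne_zero, _, ⟨_, rfl⟩, _, ⟨_, rfl⟩, h⟩

end Cotorsion

theorem propositionp (G : Type u) [AddCommGroup G] (hG : IsCotorsion G) (l : Ordinal.{u}) :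
    ulmLength G ≤ l ↔ ∀ p : ℕ, p.Prime → pLength G p ≤ Ordinal.omega0 * l := by
  constructor
  · intro h p hp
    rw [ulmLength_le_iff] at h
    rw [pLength_le_iff]
    refine le_antisymm (pPowSubgroup_antitone p (Order.le_succ _)) fun x hx => ?_
    rw [pPowSubgroup, transIter_add_one, ← pPowSubgroup]
    obtain ⟨D, K, hD, hK, b, hb, a, ha, rfl⟩ := hG.exists_add_eq hp x
    have hDl := le_pPowSubgroup_of_le_mulSubgroup hD (Ordinal.omega0 * l)
    refine add_mem (mulSubgroup_mono p hDl (hD hb)) ?_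
    have hau : a ∈ ulmSubgroup G l := by
      refine mem_ulmSubgroup_iff.mpr fun q hq => ?_
      by_cases hqp : q = p
      · subst hqp
        exact (add_mem_cancel_left (hDl hb)).mp hx
      · exact le_pPowSubgroup_of_le_mulSubgroup (hK q hq hqp) _ ha
    rw [← h, ulmSubgroup, transIter_add_one, ← ulmSubgroup] at hau
    simp only [AddSubgroup.mem_iInf] at hau
    exact mulSubgroup_mono p (fun y hy => mem_ulmSubgroup_iff.mp hy p hp) (hau p hp.one_le)
  · intro h
    rw [ulmLength_le_iff]
    ext x
    rw [mem_ulmSubgroup_iff, mem_ulmSubgroup_iff]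
    refine forall₂_congr fun p hp => ?_
    have hstab := pLength_le_iff.mp (h p hp)
    rw [pPowSubgroup, pPowSubgroup, transIter_eq_of_stable (mulSubgroup_le p) hstab]
    gcongr
    exact Order.le_succ l
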